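/- Let $(\mu_\alpha)$ be a net of Radon sub-probability measures on $\mathbb R$ and $(t_\alpha)$ a net in $]0,+\infty[$ (with the same directed index set) converging to $0$. For $\lambda\in\mathbb R$ say that $L(\lambda)$ exists if $$\log\liminf_\alpha\Big(\int e^{\lambda x/t_\alpha}\mu_\alpha(dx)\Big)^{t_\alpha}=\log\limsup_\alpha\Big(\int e^{\lambda x/t_\alpha}\mu_\alpha(dx)\Big)^{t_\alpha},$$ and let $L(\lambda)\in[-\infty,+\infty]$ be the common value. For $x\in\mathbb R$ put $l_1(x)=-\log\inf\{\liminf_\alpha\mu_\alpha(U)^{t_\alpha}: U\subset\mathbb R \text{ open},\ x\in U\}$. Assume that $L(\lambda)$ exists and is finite for all $\lambda$ in a nonempty open interval $G\subset\mathbb R$. Let $\widehat{L_{|G}}$ be the function on $\mathbb R$ equal to $L$ on $G$ and to $+\infty$ off $G$, and let ${L_{|G}}^*(x)=\sup_{\lambda\in\mathbb R}\{\lambda x-\widehat{L_{|G}}(\lambda)\}=\sup_{\lambda\in G}\{\lambda x-L(\lambda)\}$. Let $\operatorname{ran}{L_{|G}}'_-$ and $\operatorname{ran}{L_{|G}}'_+$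 be the sets of values of the left and right derivatives of $L$ at the points of $G$. For $f:\mathbb R\to[-\infty,+\infty]$ put $\operatorname{Dom}(f)=\{f<+\infty\}$. A vague large deviation principle with powers $(t_\alpha)$ and rate function $J$ holds for $(\mu_\alpha)$ if $J:\mathbb R\to[0,+\infty]$ is lower semi-continuous, $\limsup_\alpha\mu_\alpha(K)^{t_\alpha}\le\sup_{x\in K}e^{-J(x)}$ for all compact $K\subset\mathbb R$, and $\sup_{x\in U}e^{-J(x)}\le\liminf_\alpha\mu_\alpha(U)^{t_\alpha}$ for all open $U\subset\mathbb R$. It is a (narrow) large deviation principle if the upper bound holds for all closed sets. A proper convex function $f$ on $\mathbb R$ is essentially smooth if $\operatorname{int}\operatorname{Dom}(f)\ne\emptyset$, $f$ is differentiable there, and $|f'(x_n)|\to+\infty$ for every sequence $(x_n)$ in $\operatorname{int}\operatorname{Dom}(f)$ converging to a boundary point of $\operatorname{Dom}(f)$. (a) If $$\operatorname{ran}{L_{|G}}'_-\cup\operatorname{ran}{L_{|G}}'_+\supset\operatorname{int}\operatorname{Dom}({L_{|G}}^*),\qquad(1)$$ then $(\mu_\alpha)$ satisfies a vague large deviation principle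 with powers $(t_\alpha)$ and rate function ${L_{|G}}^*$. Condition (1) is satisfied in particular when $\widehat{L_{|G}}$ is essentially smooth. (b) If $0\in G$ and $$\operatorname{ran}{L_{|G}}'_-\cup\operatorname{ran}{L_{|G}}'_+\supset\operatorname{int}\operatorname{Dom}({L_{|G}}^*)\cap\{l_1>-L(0)\},$$ then $(\mu_\alpha)$ satisfies a (narrow) large deviation principle with powers $(t_\alpha)$ and rate function ${L_{|G}}^*$. -/

import Mathlib

open MeasureTheory Set Filter Topology
open scoped ENNReal

namespace LargeDev

noncomputable section

/-- The quantity `μ^t(e^{h/t}) = (∫ e^{h(x)/t} μ(dx))^t`, with values in `[0,∞]`. -/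
def powInt {X : Type*} [MeasurableSpace X] (μ : Measure X) (t : ℝ) (h : X → ℝ) : ℝ≥0∞ :=
  (∫⁻ x, ENNReal.ofReal (Real.exp (h x / t)) ∂μ) ^ t

/-- The lower functional `log liminf μ_i^{t_i}(e^{h/t_i})`, with values in `[-∞,∞]`. -/
def lowerLambda {ι X : Type*} [MeasurableSpace X] (l : Filter ι) (μ : ι → Measure X)
    (t : ι → ℝ) (h : X → ℝ) : EReal :=
  ENNReal.log (liminf (fun i => powInt (μ i) (t i) h) l)

/-- The upper functional `log limsup μ_i^{t_i}(e^{h/t_i})`, with values in `[-∞,∞]`. -/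
def upperLambda {ι X : Type*} [MeasurableSpace X] (l : Filter ι) (μ : ι → Measure X)
    (t : ι → ℝ) (h : X → ℝ) : EReal :=
  ENNReal.log (limsup (fun i => powInt (μ i) (t i) h) l)

/-- `Λ(h)` exists and is equal to `c`: the lower and the upper functional both equal `c`. -/
def HasLambda {ι X : Type*} [MeasurableSpace X] (l : Filter ι) (μ : ι → Measure X)
    (t : ι → ℝ) (h : X → ℝ) (c : EReal) : Prop :=
  lowerLambda l μ t h = c ∧ upperLambda l μ t h = c

/-- `l₁(x) = - log inf {liminf μ_i^{t_i}(U) : U open, x ∈ U}`. -/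
def lOne {ι X : Type*} [TopologicalSpace X] [MeasurableSpace X] (l : Filter ι)
    (μ : ι → Measure X) (t : ι → ℝ) (x : X) : EReal :=
  - ENNReal.log (⨅ U : Set X, ⨅ _ : IsOpen U ∧ x ∈ U, liminf (fun i => (μ i U) ^ (t i)) l)

/-- `μ` satisfies a vague large deviation principle with powers `t` and rate function `J`:
upper bound for compact sets, lower bound for open sets. -/
structure VagueLDP {ι X : Type*} [TopologicalSpace X] [MeasurableSpace X] (l : Filter ι)
    (μ : ι → Measure X) (t : ι → ℝ) (J : X → EReal) : Prop where
  nonneg : ∀ x, 0 ≤ J x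
  lsc : LowerSemicontinuous J
  upper : ∀ K : Set X, IsCompact K →
    limsup (fun i => (μ i K) ^ (t i)) l ≤ ⨆ x ∈ K, EReal.exp (- J x)
  lower : ∀ U : Set X, IsOpen U →
    ⨆ x ∈ U, EReal.exp (- J x) ≤ liminf (fun i => (μ i U) ^ (t i)) l

/-- `μ` satisfies a (narrow) large deviation principle with powers `t` and rate function `J`:
upper bound for closed sets, lower bound for open sets. -/
structure NarrowLDP {ι X : Type*} [TopologicalSpace X] [MeasurableSpace X] (l : Filter ι)
    (μ : ι → Measure X) (t : ι → ℝ) (J : X → EReal) : Prop where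
  nonneg : ∀ x, 0 ≤ J x
  lsc : LowerSemicontinuous J
  upper : ∀ F : Set X, IsClosed F →
    limsup (fun i => (μ i F) ^ (t i)) l ≤ ⨆ x ∈ F, EReal.exp (- J x)
  lower : ∀ U : Set X, IsOpen U →
    ⨆ x ∈ U, EReal.exp (- J x) ≤ liminf (fun i => (μ i U) ^ (t i)) l

/-- The effective domain `{f < +∞}`. -/
def effDom (f : ℝ → EReal) : Set ℝ := {x | f x < ⊤}

/-- `f` is a proper convex function on `ℝ`: its epigraph is convex, it never takes the value
`-∞`, and it takes a finite value. -/
def ProperConvex (f : ℝ → EReal) : Prop :=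
  Convex ℝ {p : ℝ × ℝ | f p.1 ≤ (p.2 : EReal)} ∧ (∀ x, f x ≠ ⊥) ∧ ∃ x, f x ≠ ⊤

/-- The Legendre-Fenchel transform `f*(x) = sup_{y ∈ ℝ} (y x - f(y))`. -/
def legendre (f : ℝ → EReal) (x : ℝ) : EReal :=
  ⨆ y : ℝ, ((y * x : ℝ) : EReal) - f y

open Classical in
/-- The extension of `f|_G` to `ℝ` by `+∞` outside `G`. -/
def extendTop (G : Set ℝ) (f : ℝ → ℝ) (y : ℝ) : EReal :=
  if y ∈ G then (f y : EReal) else ⊤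

/-- Essential smoothness of a proper convex function on `ℝ`. -/
structure EssentiallySmooth (f : ℝ → EReal) : Prop where
  properConvex : ProperConvex f
  nonempty : (interior (effDom f)).Nonempty
  differentiable : ∀ x ∈ interior (effDom f), DifferentiableAt ℝ (fun y => (f y).toReal) x
  steep : ∀ (u : ℕ → ℝ) (x : ℝ), (∀ n, u n ∈ interior (effDom f)) →
    x ∈ frontier (effDom f) → Tendsto u atTop (𝓝 x) →
    Tendsto (fun n => |deriv (fun y => (f y).toReal) (u n)|) atTop atTop

/-- The set of all left derivatives of `f` at points of the open set `G`. -/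
def ranLeftDeriv (G : Set ℝ) (f : ℝ → ℝ) : Set ℝ :=
  {d | ∃ y ∈ G, HasDerivWithinAt f d (Iio y) y}

/-- The set of all right derivatives of `f` at points of the open set `G`. -/
def ranRightDeriv (G : Set ℝ) (f : ℝ → ℝ) : Set ℝ :=
  {d | ∃ y ∈ G, HasDerivWithinAt f d (Ioi y) y}

end

end LargeDev

/-!
Write `J` for the Legendre transform of `L` restricted to `G`, so that
`J x = sup_{y ∈ G} (y x - L y)`. Everything is read off from the tilted masses
`(∫_S e^{y x / t} μ(dx))^t`: they obey Chernoff bounds, and the rate of a finite union is the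
largest rate of its parts because `2 ^ t → 1`.

*Upper bounds.* Near `x`, a parameter `y ∈ G` that almost attains the supremum in `J x` bounds the
mass by `e^{-J x}` up to a small error, and compactness does the rest. If `0 ∈ G`, finiteness of
`L` on both sides of `0` gives exponential tightness, which extends the bound to closed sets.

*Lower bounds.* Suppose `x` is a one-sided derivative of `L` at `y`
(`exp_neg_legendre_le_liminf_of_mem_ran`). Differentiability at `y` is not needed: there are
`m ∈ G` close to `y` and `h ≠ 0` such that the difference quotients of `L` on both sides of `m`
with step `h` are close to `x` (take `y`, `m` and `2 m - y`). Chernoff bounds with parameters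
`m ± h` show that the measures tilted by `m` concentrate near `x`; undoing the tilt gives the rate
`y x - L y ≤ J x`. For the narrow principle, a point
with `lOne x ≤ -L 0` needs no tilting since `J ≥ -L 0`.

From the interior of the domain of `J` the lower bound spreads to the whole domain by convexity of
`J` along segments (`exp_neg_legendre_le_liminf`). When that interior is empty, the domain is a
single point, `G` contains `0`, and half-lines that avoid the point are superexponentially
negligible. The lower bound for the whole line gives `0 ≤ J`, the total masses being at most `1`.

*Essential smoothness.* If `x` lies in the interior of the domain of `J`, then `L'` takes values
on both sides of `x` (`exists_le_deriv` and its reflection), and Darboux's theorem applies.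
-/

namespace LargeDev

/-! ### Tilted masses and their exponential rates -/

/-- The tilted mass `(∫_S e^{y x / t} μ(dx))^t`. For `S = univ` it is the quantity whose limit
defines `L y`, and for `y = 0` it is `μ(S)^t`. -/
noncomputable def tiltedMass (μ : Measure ℝ) (t y : ℝ) (S : Set ℝ) : ℝ≥0∞ :=
  (∫⁻ x in S, ENNReal.ofReal (Real.exp (y * x / t)) ∂μ) ^ t

lemma tiltedMass_zero (μ : Measure ℝ) (t : ℝ) (S : Set ℝ) : tiltedMass μ t 0 S = μ S ^ t := by
  simp [tiltedMass]

lemma tiltedMass_univ (μ : Measure ℝ) (t y : ℝ) :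
    tiltedMass μ t y univ = powInt μ t (fun x => y * x) := by
  simp [tiltedMass, powInt]

lemma tiltedMass_mono {μ : Measure ℝ} {t : ℝ} (ht : 0 < t) (y : ℝ) {S T : Set ℝ} (h : S ⊆ T) :
    tiltedMass μ t y S ≤ tiltedMass μ t y T :=
  ENNReal.rpow_le_rpow (lintegral_mono_set h) ht.le

/-- The exponential Chebyshev inequality, with an arbitrary change of the tilting parameter. -/
lemma tiltedMass_le_exp_mul {μ : Measure ℝ} {t : ℝ} (ht : 0 < t) {y y' b : ℝ} {S : Set ℝ}
    (hS : MeasurableSet S) (h : ∀ x ∈ S, y' * x ≤ y * x + b) :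
    tiltedMass μ t y' S ≤ ENNReal.ofReal (Real.exp b) * tiltedMass μ t y S := by
  have hb : ENNReal.ofReal (Real.exp b) = ENNReal.ofReal (Real.exp (b / t)) ^ t := by
    rw [ENNReal.ofReal_rpow_of_pos (Real.exp_pos _), ← Real.exp_mul, div_mul_cancel₀ _ ht.ne']
  rw [tiltedMass, tiltedMass, hb, ← ENNReal.mul_rpow_of_nonneg _ _ ht.le]
  refine ENNReal.rpow_le_rpow ?_ ht.le
  rw [← lintegral_const_mul' _ _ ENNReal.ofReal_ne_top]
  refine setLIntegral_mono' hS fun x hx => ?_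
  rw [← ENNReal.ofReal_mul (Real.exp_pos _).le, ← Real.exp_add]
  refine ENNReal.ofReal_le_ofReal (Real.exp_le_exp.2 ?_)
  rw [← add_div]
  have := h x hx
  gcongr
  linarith

lemma tiltedMass_union_le {μ : Measure ℝ} {t : ℝ} (ht : 0 < t) (y : ℝ) (S T : Set ℝ) :
    tiltedMass μ t y (S ∪ T) ≤ 2 ^ t * max (tiltedMass μ t y S) (tiltedMass μ t y T) := by
  have hmono : Monotone fun a : ℝ≥0∞ => a ^ t := ENNReal.monotone_rpow_of_nonneg ht.le
  rw [tiltedMass, tiltedMass, tiltedMass, ← hmono.map_max, ← ENNReal.mul_rpow_of_nonneg _ _ ht.le]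
  refine ENNReal.rpow_le_rpow ((lintegral_union_le _ S T).trans ?_) ht.le
  rw [two_mul]
  exact add_le_add (le_max_left _ _) (le_max_right _ _)

section Net

variable {ι : Type*} {l : Filter ι} {μ : ι → Measure ℝ} {t : ι → ℝ}

/-- The factor `2 ^ t` in `tiltedMass_union_le` disappears in the limit. -/
lemma eventually_tiltedMass_union_lt (ht_pos : ∀ i, 0 < t i) (ht : Tendsto t l (𝓝 0))
    (y : ℝ) (S T : Set ℝ) {c d : ℝ≥0∞} (hcd : c < d) :
    ∀ᶠ i in l, tiltedMass (μ i) (t i) y S < c → tiltedMass (μ i) (t i) y T < c →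
      tiltedMass (μ i) (t i) y (S ∪ T) < d := by
  have h2 : Tendsto (fun i => (2 : ℝ≥0∞) ^ t i * c) l (𝓝 c) := by
    have h : Tendsto (fun i => (2 : ℝ≥0∞) ^ t i) l (𝓝 1) := by
      have hreal : Tendsto (fun i => (2 : ℝ) ^ t i) l (𝓝 1) := by
        simpa using tendsto_const_nhds.rpow ht (Or.inl (two_ne_zero (α := ℝ)))
      simpa [← ENNReal.ofReal_rpow_of_pos] using ENNReal.tendsto_ofReal hreal
    simpa using ENNReal.Tendsto.mul_const h (Or.inl one_ne_zero)
  filter_upwards [h2.eventually_lt_const hcd] with i hi hS hT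
  refine ((tiltedMass_union_le (ht_pos i) y S T).trans ?_).trans_lt hi
  gcongr
  exact (max_lt hS hT).le

lemma limsup_tiltedMass_union_le (ht_pos : ∀ i, 0 < t i) (ht : Tendsto t l (𝓝 0))
    (y : ℝ) {S T : Set ℝ} {c : ℝ≥0∞}
    (hS : limsup (fun i => tiltedMass (μ i) (t i) y S) l ≤ c)
    (hT : limsup (fun i => tiltedMass (μ i) (t i) y T) l ≤ c) :
    limsup (fun i => tiltedMass (μ i) (t i) y (S ∪ T)) l ≤ c := by
  refine le_of_forall_gt fun d hd => ?_
  obtain ⟨d', hcd', hd'⟩ := exists_between hd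
  obtain ⟨e, hce, hed'⟩ := exists_between hcd'
  refine (limsup_le_of_le (h := ?_)).trans_lt hd'
  filter_upwards [eventually_tiltedMass_union_lt (μ := μ) ht_pos ht y S T hed',
    eventually_lt_of_limsup_lt (hS.trans_lt hce),
    eventually_lt_of_limsup_lt (hT.trans_lt hce)] with i hi h1 h2
  exact (hi h1 h2).le

/-- If `T` is exponentially negligible in `S ∪ T`, then `S` carries the whole rate. -/
lemma liminf_tiltedMass_union_le (ht_pos : ∀ i, 0 < t i) (ht : Tendsto t l (𝓝 0))
    (y : ℝ) {S T : Set ℝ}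
    (h : limsup (fun i => tiltedMass (μ i) (t i) y T) l <
      liminf (fun i => tiltedMass (μ i) (t i) y (S ∪ T)) l) :
    liminf (fun i => tiltedMass (μ i) (t i) y (S ∪ T)) l ≤
      liminf (fun i => tiltedMass (μ i) (t i) y S) l := by
  -- Otherwise both parts are frequently below a level `c` that is smaller than the total rate.
  by_contra! hlt
  obtain ⟨c, hc, hcd⟩ := exists_between (max_lt hlt h)
  obtain ⟨d, hcd, hd⟩ := exists_between hcd
  have hfreq : ∃ᶠ i in l, tiltedMass (μ i) (t i) y S < c :=
    frequently_lt_of_liminf_lt (h := (le_max_left _ _).trans_lt hc)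
  refine hd.not_ge (liminf_le_of_frequently_le ?_)
  refine (hfreq.and_eventually ((eventually_tiltedMass_union_lt (μ := μ) ht_pos ht y S T hcd).and
    (eventually_lt_of_limsup_lt ((le_max_right _ _).trans_lt hc)))).mono ?_
  rintro i ⟨h1, h2, h3⟩
  exact (h2 h1 h3).le

lemma limsup_tiltedMass_le_exp_mul [l.NeBot] (ht_pos : ∀ i, 0 < t i) {y y' b : ℝ} {S : Set ℝ}
    (hS : MeasurableSet S) (h : ∀ x ∈ S, y' * x ≤ y * x + b) :
    limsup (fun i => tiltedMass (μ i) (t i) y' S) l ≤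
      ENNReal.ofReal (Real.exp b) * limsup (fun i => tiltedMass (μ i) (t i) y S) l := by
  rw [← ENNReal.limsup_const_mul_of_ne_top ENNReal.ofReal_ne_top]
  exact limsup_le_limsup (Eventually.of_forall fun i => tiltedMass_le_exp_mul (ht_pos i) hS h)

lemma liminf_tiltedMass_le_exp_mul [l.NeBot] (ht_pos : ∀ i, 0 < t i) {y y' b : ℝ} {S : Set ℝ}
    (hS : MeasurableSet S) (h : ∀ x ∈ S, y' * x ≤ y * x + b) :
    liminf (fun i => tiltedMass (μ i) (t i) y' S) l ≤
      ENNReal.ofReal (Real.exp b) * liminf (fun i => tiltedMass (μ i) (t i) y S) l := by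
  have hc : Continuous fun a : ℝ≥0∞ => ENNReal.ofReal (Real.exp b) * a :=
    ENNReal.continuous_const_mul ENNReal.ofReal_ne_top
  have hm : Monotone fun a : ℝ≥0∞ => ENNReal.ofReal (Real.exp b) * a :=
    fun _ _ hab => mul_le_mul_right hab _
  have := hm.map_liminf_of_continuousAt (F := l)
    (fun i => tiltedMass (μ i) (t i) y S) hc.continuousAt
  rw [this]
  exact liminf_le_liminf (Eventually.of_forall fun i => tiltedMass_le_exp_mul (ht_pos i) hS h)

lemma limsup_tiltedMass_univ {y c : ℝ} (h : HasLambda l μ t (fun x => y * x) (c : EReal)) :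
    limsup (fun i => tiltedMass (μ i) (t i) y univ) l = ENNReal.ofReal (Real.exp c) := by
  simp only [tiltedMass_univ]
  rw [← EReal.exp_coe, ← h.2, upperLambda, ENNReal.exp_log]

lemma liminf_tiltedMass_univ {y c : ℝ} (h : HasLambda l μ t (fun x => y * x) (c : EReal)) :
    liminf (fun i => tiltedMass (μ i) (t i) y univ) l = ENNReal.ofReal (Real.exp c) := by
  simp only [tiltedMass_univ]
  rw [← EReal.exp_coe, ← h.1, lowerLambda, ENNReal.exp_log]

/-- The Chernoff bound in the limit. -/
lemma limsup_tiltedMass_le_exp [l.NeBot] (ht_pos : ∀ i, 0 < t i) {y y' b c : ℝ} {S : Set ℝ}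
    (hL : HasLambda l μ t (fun x => y * x) (c : EReal))
    (hS : MeasurableSet S) (h : ∀ x ∈ S, y' * x ≤ y * x + b) :
    limsup (fun i => tiltedMass (μ i) (t i) y' S) l ≤ ENNReal.ofReal (Real.exp (c + b)) := by
  rw [add_comm, Real.exp_add, ENNReal.ofReal_mul (Real.exp_pos _).le, ← limsup_tiltedMass_univ hL]
  refine (limsup_tiltedMass_le_exp_mul ht_pos hS h).trans ?_
  exact mul_le_mul_right (limsup_le_limsup
    (Eventually.of_forall fun i => tiltedMass_mono (ht_pos i) y (subset_univ S))) _

end Net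

/-! ### The Legendre transform of a function extended by `+∞` -/

section Legendre

variable {G : Set ℝ} {L : ℝ → ℝ}

lemma legendre_extendTop_le_iff {x : ℝ} {c : EReal} :
    legendre (extendTop G L) x ≤ c ↔ ∀ y ∈ G, ((y * x - L y : ℝ) : EReal) ≤ c := by
  rw [legendre, iSup_le_iff]
  refine forall_congr' fun y => ?_
  by_cases hy : y ∈ G
  · simp [extendTop, hy, EReal.coe_sub]
  · simp [extendTop, hy]

lemma le_legendre_extendTop {y : ℝ} (hy : y ∈ G) (x : ℝ) :
    ((y * x - L y : ℝ) : EReal) ≤ legendre (extendTop G L) x :=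
  legendre_extendTop_le_iff.1 le_rfl y hy

lemma lt_legendre_extendTop_iff {x : ℝ} {c : EReal} :
    c < legendre (extendTop G L) x ↔ ∃ y ∈ G, c < ((y * x - L y : ℝ) : EReal) := by
  rw [← not_le, legendre_extendTop_le_iff]
  push Not
  rfl

lemma legendre_ne_bot (hG : G.Nonempty) (x : ℝ) : legendre (extendTop G L) x ≠ ⊥ := by
  obtain ⟨y, hy⟩ := hG
  exact ((EReal.bot_lt_coe _).trans_le (le_legendre_extendTop hy x)).ne'

lemma lowerSemicontinuous_legendre : LowerSemicontinuous (legendre (extendTop G L)) := by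
  intro x c hc
  obtain ⟨y, hy, hcy⟩ := lt_legendre_extendTop_iff.1 hc
  have hcont : Continuous fun z : ℝ => ((y * z - L y : ℝ) : EReal) :=
    continuous_coe_real_ereal.comp (by fun_prop)
  filter_upwards [hcont.continuousAt.eventually_const_lt hcy] with z hz
  exact lt_legendre_extendTop_iff.2 ⟨y, hy, hz⟩

lemma exists_legendre_eq_coe (hG : G.Nonempty) {x : ℝ}
    (hx : x ∈ effDom (legendre (extendTop G L))) :
    ∃ a : ℝ, legendre (extendTop G L) x = (a : EReal) :=
  ⟨_, (EReal.coe_toReal (ne_of_lt hx) (legendre_ne_bot hG x)).symm⟩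

/-- Convexity of the Legendre transform along a segment, for upper bounds of its values. -/
lemma legendre_segment_le {x z a b s : ℝ} (hx : legendre (extendTop G L) x ≤ (a : EReal))
    (hz : legendre (extendTop G L) z ≤ (b : EReal)) (h0 : 0 ≤ s) (h1 : s ≤ 1) :
    legendre (extendTop G L) ((1 - s) * x + s * z) ≤ (((1 - s) * a + s * b : ℝ) : EReal) := by
  refine legendre_extendTop_le_iff.2 fun y hy => ?_
  have h2 := EReal.coe_le_coe_iff.1 (legendre_extendTop_le_iff.1 hx y hy)
  have h3 := EReal.coe_le_coe_iff.1 (legendre_extendTop_le_iff.1 hz y hy)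
  rw [EReal.coe_le_coe_iff]
  have h4 := mul_le_mul_of_nonneg_left h2 (sub_nonneg.2 h1)
  have h5 := mul_le_mul_of_nonneg_left h3 h0
  linarith

lemma convex_effDom_legendre (hG : G.Nonempty) :
    Convex ℝ (effDom (legendre (extendTop G L))) := by
  intro x hx z hz r s hr hs hrs
  obtain ⟨a, ha⟩ := exists_legendre_eq_coe hG hx
  obtain ⟨b, hb⟩ := exists_legendre_eq_coe hG hz
  have := legendre_segment_le ha.le hb.le hs (by linarith)
  rw [← eq_sub_of_add_eq hrs] at this
  exact this.trans_lt (EReal.coe_lt_top _)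

end Legendre

/-! ### Upper bounds -/

section Upper

variable {ι : Type*} {l : Filter ι} [l.NeBot] {μ : ι → Measure ℝ} {t : ι → ℝ}
  {G : Set ℝ} {L : ℝ → ℝ}

/-- The local upper bound: a parameter `y` that almost attains the supremum defining the Legendre
transform at `x` controls the mass of the half-line (the whole line if `y = 0`) around `x` on which
`y z` is not much smaller than `y x`. -/
lemma exists_nhds_limsup_le (ht_pos : ∀ i, 0 < t i)
    (hL : ∀ y ∈ G, HasLambda l μ t (fun x => y * x) (L y : EReal)) {x : ℝ} {c : ℝ≥0∞}
    (hc : EReal.exp (-legendre (extendTop G L) x) < c) :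
    ∃ V ∈ 𝓝 x, limsup (fun i => (μ i V) ^ t i) l ≤ c := by
  have hc' : -ENNReal.log c < legendre (extendTop G L) x := by
    rwa [EReal.neg_lt_comm, ← EReal.exp_lt_exp_iff, ENNReal.exp_log]
  obtain ⟨y, hy, hyc⟩ := lt_legendre_extendTop_iff.1 hc'
  obtain ⟨r, hr, hry⟩ := EReal.lt_iff_exists_real_btwn.1 hyc
  rw [EReal.coe_lt_coe_iff] at hry
  have hopen : IsOpen {z : ℝ | r + L y < y * z} := isOpen_lt (by fun_prop) (by fun_prop)
  refine ⟨_, hopen.mem_nhds (show r + L y < y * x by linarith), ?_⟩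
  simp only [← tiltedMass_zero]
  refine (limsup_tiltedMass_le_exp (b := -(r + L y)) ht_pos (hL y hy) hopen.measurableSet
    fun z hz => ?_).trans ?_
  · have : r + L y < y * z := hz
    linarith
  · rw [show L y + -(r + L y) = -r by ring, ← EReal.exp_coe, ← ENNReal.exp_log c]
    refine EReal.exp_monotone ?_
    rw [EReal.coe_neg]
    exact (EReal.neg_lt_comm.1 hr).le

lemma limsup_isCompact_le (ht_pos : ∀ i, 0 < t i) (ht : Tendsto t l (𝓝 0))
    (hL : ∀ y ∈ G, HasLambda l μ t (fun x => y * x) (L y : EReal)) {K : Set ℝ}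
    (hK : IsCompact K) :
    limsup (fun i => (μ i K) ^ t i) l ≤
      ⨆ x ∈ K, EReal.exp (-legendre (extendTop G L) x) := by
  refine le_of_forall_gt_imp_ge_of_dense fun c hc => ?_
  refine hK.induction_on (p := fun S => limsup (fun i => (μ i S) ^ t i) l ≤ c) ?_ ?_ ?_ ?_
  · simp [ENNReal.zero_rpow_of_pos, ht_pos]
  · intro S T hST hT
    refine (limsup_le_limsup (Eventually.of_forall fun i => ?_)).trans hT
    exact ENNReal.rpow_le_rpow (measure_mono hST) (ht_pos i).le
  · intro S T hS hT
    simp only [← tiltedMass_zero] at hS hT ⊢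
    exact limsup_tiltedMass_union_le ht_pos ht 0 hS hT
  · intro x hx
    obtain ⟨V, hV, hVc⟩ := exists_nhds_limsup_le ht_pos hL
      ((le_iSup₂ (f := fun x _ => EReal.exp (-legendre (extendTop G L) x)) x hx).trans_lt hc)
    exact ⟨V, mem_nhdsWithin_of_mem_nhds hV, hVc⟩

/-- Exponential tightness, from the finiteness of `L` on both sides of `0`. -/
lemma exists_limsup_compl_Icc_le (ht_pos : ∀ i, 0 < t i) (ht : Tendsto t l (𝓝 0))
    (hL : ∀ y ∈ G, HasLambda l μ t (fun x => y * x) (L y : EReal)) (hG : G ∈ 𝓝 0)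
    {c : ℝ≥0∞} (hc : 0 < c) :
    ∃ R : ℝ, limsup (fun i => (μ i (Icc (-R) R)ᶜ) ^ t i) l ≤ c := by
  obtain ⟨d, hd, hdG⟩ := Metric.nhds_basis_closedBall.mem_iff.1 hG
  have hmem : ∀ y : ℝ, |y| ≤ d → y ∈ G := fun y hy => hdG (by simpa using hy)
  have hlim : ∀ a : ℝ, Tendsto (fun R : ℝ => ENNReal.ofReal (Real.exp (a + -(d * R)))) atTop
      (𝓝 0) := by
    intro a
    rw [← ENNReal.ofReal_zero]
    refine ENNReal.tendsto_ofReal (Real.tendsto_exp_atBot.comp ?_)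
    exact tendsto_atBot_add_const_left _ _
      (tendsto_neg_atTop_atBot.comp (tendsto_id.const_mul_atTop hd))
  obtain ⟨R, hR1, hR2⟩ :=
    (((hlim (L d)).eventually_lt_const hc).and ((hlim (L (-d))).eventually_lt_const hc)).exists
  refine ⟨R, ?_⟩
  have hunion : (Icc (-R) R)ᶜ = Ioi R ∪ Iio (-R) := by
    ext z
    simp only [mem_compl_iff, mem_Icc, not_and_or, not_le, mem_union, mem_Ioi, mem_Iio]
    exact or_comm
  simp only [← tiltedMass_zero, hunion]
  refine limsup_tiltedMass_union_le ht_pos ht 0 ?_ ?_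
  · refine (limsup_tiltedMass_le_exp ht_pos (hL d (hmem d (abs_of_pos hd).le))
      measurableSet_Ioi fun z hz => ?_).trans hR1.le
    have := mul_lt_mul_of_pos_left (mem_Ioi.1 hz) hd
    linarith
  · refine (limsup_tiltedMass_le_exp ht_pos
      (hL (-d) (hmem (-d) (by rw [abs_neg]; exact (abs_of_pos hd).le)))
      measurableSet_Iio fun z hz => ?_).trans hR2.le
    have := mul_lt_mul_of_pos_left (mem_Iio.1 hz) hd
    linarith

lemma limsup_isClosed_le (ht_pos : ∀ i, 0 < t i) (ht : Tendsto t l (𝓝 0))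
    (hL : ∀ y ∈ G, HasLambda l μ t (fun x => y * x) (L y : EReal)) (hG : G ∈ 𝓝 0) {F : Set ℝ}
    (hF : IsClosed F) :
    limsup (fun i => (μ i F) ^ t i) l ≤
      ⨆ x ∈ F, EReal.exp (-legendre (extendTop G L) x) := by
  refine le_of_forall_gt_imp_ge_of_dense fun c hc => ?_
  obtain ⟨R, hR⟩ := exists_limsup_compl_Icc_le ht_pos ht hL hG (bot_le.trans_lt hc)
  have hK := limsup_isCompact_le ht_pos ht hL ((isCompact_Icc (a := -R) (b := R)).inter_left hF)
  have hK' := (hK.trans (biSup_mono fun x hx => hx.1)).trans hc.le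
  simp only [← tiltedMass_zero] at hK' hR ⊢
  refine (limsup_le_limsup (Eventually.of_forall fun i => ?_)).trans
    (limsup_tiltedMass_union_le ht_pos ht 0 hK' hR)
  refine tiltedMass_mono (ht_pos i) 0 fun x hx => ?_
  by_cases h : x ∈ Icc (-R) R
  · exact Or.inl ⟨hx, h⟩
  · exact Or.inr h

end Upper

/-! ### Lower bounds at one-sided derivatives -/

section Lower

variable {ι : Type*} {l : Filter ι} [l.NeBot] {μ : ι → Measure ℝ} {t : ι → ℝ}
  {G : Set ℝ} {L : ℝ → ℝ}

/-- If the difference quotients of `L` between `m` and `m ± h` are within `ε` of `x` (in the one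
relevant direction each), the measures tilted by `m` concentrate on the ball of radius `ε` about
`x`, and this bounds the untilted mass of the ball from below. -/
lemma exp_le_liminf_ball (ht_pos : ∀ i, 0 < t i) (ht : Tendsto t l (𝓝 0))
    (hL : ∀ y ∈ G, HasLambda l μ t (fun x => y * x) (L y : EReal)) {x m h ε : ℝ}
    (hm : m ∈ G) (hq : m + h ∈ G) (hp : m - h ∈ G)
    (hqm : L (m + h) - L m < h * x + |h| * ε) (hpm : L (m - h) - L m < -(h * x) + |h| * ε) :
    ENNReal.ofReal (Real.exp (L m - (m * x + |m| * ε))) ≤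
      liminf (fun i => (μ i (Metric.ball x ε)) ^ t i) l := by
  have hS : ∀ k : ℝ, MeasurableSet {z : ℝ | |k| * ε ≤ k * (z - x)} := fun k =>
    measurableSet_le measurable_const (by fun_prop)
  have hbound : ∀ k : ℝ, m + k ∈ G →
      limsup (fun i => tiltedMass (μ i) (t i) m {z : ℝ | |k| * ε ≤ k * (z - x)}) l ≤
        ENNReal.ofReal (Real.exp (L (m + k) + -(k * x + |k| * ε))) := fun k hk =>
    limsup_tiltedMass_le_exp ht_pos (hL _ hk) (hS k) fun z hz => by
      have : |k| * ε ≤ k * (z - x) := hz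
      linarith
  have hcover : Metric.ball x ε ∪
      ({z : ℝ | |h| * ε ≤ h * (z - x)} ∪ {z : ℝ | |-h| * ε ≤ -h * (z - x)}) = univ := by
    refine eq_univ_of_forall fun z => ?_
    by_cases hz : |z - x| < ε
    · exact Or.inl (by rwa [Metric.mem_ball, Real.dist_eq])
    · have h1 : |h| * ε ≤ |h * (z - x)| := by
        rw [abs_mul]
        exact mul_le_mul_of_nonneg_left (not_lt.1 hz) (abs_nonneg h)
      right
      rcases le_abs.1 h1 with h2 | h2
      · exact Or.inl h2
      · right
        simpa [abs_neg] using h2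
  have hlt : limsup (fun i => tiltedMass (μ i) (t i) m
      ({z : ℝ | |h| * ε ≤ h * (z - x)} ∪ {z : ℝ | |-h| * ε ≤ -h * (z - x)})) l <
        ENNReal.ofReal (Real.exp (L m)) := by
    refine lt_of_le_of_lt (limsup_tiltedMass_union_le ht_pos ht m
      ((hbound h hq).trans (le_max_left _ _))
      ((hbound (-h) (by rwa [← sub_eq_add_neg])).trans (le_max_right _ _))) (max_lt ?_ ?_)
    · rw [ENNReal.ofReal_lt_ofReal_iff (Real.exp_pos _), Real.exp_lt_exp]
      linarith
    · rw [ENNReal.ofReal_lt_ofReal_iff (Real.exp_pos _), Real.exp_lt_exp, abs_neg,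
        ← sub_eq_add_neg m h]
      linarith
  have huniv := liminf_tiltedMass_univ (hL m hm)
  rw [← hcover] at huniv
  have h1 := liminf_tiltedMass_union_le ht_pos ht m (hlt.trans_eq huniv.symm)
  rw [huniv] at h1
  have h2 : liminf (fun i => tiltedMass (μ i) (t i) m (Metric.ball x ε)) l ≤
      ENNReal.ofReal (Real.exp (m * x + |m| * ε)) *
        liminf (fun i => tiltedMass (μ i) (t i) 0 (Metric.ball x ε)) l := by
    refine liminf_tiltedMass_le_exp_mul ht_pos measurableSet_ball fun z hz => ?_
    rw [Metric.mem_ball, Real.dist_eq] at hz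
    have h3 : m * (z - x) ≤ |m| * ε := (le_abs_self _).trans (by
      rw [abs_mul]
      exact mul_le_mul_of_nonneg_left hz.le (abs_nonneg m))
    linarith
  simp only [tiltedMass_zero] at h2
  have h3 := mul_le_mul_right (h1.trans h2) (ENNReal.ofReal (Real.exp (-(m * x + |m| * ε))))
  rw [← mul_assoc, ← ENNReal.ofReal_mul (Real.exp_pos _).le,
    ← ENNReal.ofReal_mul (Real.exp_pos _).le, ← Real.exp_add, ← Real.exp_add, neg_add_cancel,
    Real.exp_zero, ENNReal.ofReal_one, one_mul, add_comm, ← sub_eq_add_neg] at h3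
  exact h3

/-- A one-sided derivative `x` of `L` at `y` is approximated by symmetric difference quotients at
points of `G` close to `y`. The three points are `y`, `z` and `2 z - y` with `z` on the relevant
side of `y`, so that only differentiability from that side enters. -/
lemma exists_symmetric_quotient (hG : IsOpen G) {x y ε : ℝ} (hy : y ∈ G) (hε : 0 < ε)
    {A : Set ℝ} [(𝓝[A] y).NeBot] (hyA : y ∉ A) (hA : ∀ z ∈ A, 2 * z - y ∈ A)
    (hd : HasDerivWithinAt L x A y) :
    ∃ m h : ℝ, m ∈ G ∧ m + h ∈ G ∧ m - h ∈ G ∧ |m - y| < ε ∧ |L m - L y| < ε ∧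
      L (m + h) - L m < h * x + |h| * ε ∧ L (m - h) - L m < -(h * x) + |h| * ε := by
  have hdouble : Tendsto (fun z => 2 * z - y) (𝓝[A] y) (𝓝[A] y) := by
    refine tendsto_nhdsWithin_iff.2 ⟨?_, eventually_mem_nhdsWithin.mono hA⟩
    have hc : Continuous fun z : ℝ => 2 * z - y := by fun_prop
    have := hc.tendsto y
    rw [two_mul, add_sub_cancel_right] at this
    exact this.mono_left nhdsWithin_le_nhds
  -- The errors at `z` and `2 z - y` are at most `ε / 4` times `|z - y|` and `2 |z - y|`; together
  -- they stay below `|z - y| ε`.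
  have hO := (hasDerivWithinAt_iff_isLittleO.1 hd).def (show (0 : ℝ) < ε / 4 by positivity)
  have hGn : ∀ᶠ z in 𝓝[A] y, z ∈ G := mem_nhdsWithin_of_mem_nhds (hG.mem_nhds hy)
  have hLc : ∀ᶠ z in 𝓝[A] y, |L z - L y| < ε := by
    have := hd.continuousWithinAt.eventually (Metric.ball_mem_nhds (L y) hε)
    simpa [Real.dist_eq] using this
  have hzc : ∀ᶠ z in 𝓝[A] y, |z - y| < ε := by
    have := mem_nhdsWithin_of_mem_nhds (t := A) (Metric.ball_mem_nhds y hε)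
    filter_upwards [this] with z hz
    rwa [Metric.mem_ball, Real.dist_eq] at hz
  obtain ⟨z, hzA, hz1, hz2, hzG, hzG2, hzL, hzy⟩ :=
    (eventually_mem_nhdsWithin.and (hO.and ((hdouble.eventually hO).and (hGn.and
      ((hdouble.eventually hGn).and (hLc.and hzc)))))).exists
  have hne : 0 < |z - y| := abs_pos.2 (sub_ne_zero.2 fun h => hyA (h ▸ hzA))
  have e1 : 2 * z - y - y = 2 * (z - y) := by ring
  rw [e1] at hz2
  simp only [Real.norm_eq_abs, smul_eq_mul, abs_mul, abs_two] at hz1 hz2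
  have e2 : z + (z - y) = 2 * z - y := by ring
  have hpos := mul_pos hne hε
  rw [abs_le] at hz1 hz2
  refine ⟨z, z - y, hzG, ?_, ?_, hzy, hzL, ?_, ?_⟩
  · rwa [e2]
  · rwa [sub_sub_cancel]
  · rw [e2]
    linarith [hz1.1, hz2.2]
  · rw [sub_sub_cancel]
    linarith [hz1.1, hz1.2]

/-- The lower bound at a one-sided derivative of `L`. -/
lemma exp_neg_legendre_le_liminf_of_mem_ran (ht_pos : ∀ i, 0 < t i) (ht : Tendsto t l (𝓝 0))
    (hL : ∀ y ∈ G, HasLambda l μ t (fun x => y * x) (L y : EReal)) (hG : IsOpen G) {x : ℝ}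
    (hx : x ∈ ranLeftDeriv G L ∪ ranRightDeriv G L) {U : Set ℝ} (hU : U ∈ 𝓝 x) :
    EReal.exp (-legendre (extendTop G L) x) ≤ liminf (fun i => (μ i U) ^ t i) l := by
  obtain ⟨y, hy, hquot⟩ : ∃ y ∈ G, ∀ ε : ℝ, 0 < ε →
      ∃ m h : ℝ, m ∈ G ∧ m + h ∈ G ∧ m - h ∈ G ∧ |m - y| < ε ∧ |L m - L y| < ε ∧
        L (m + h) - L m < h * x + |h| * ε ∧ L (m - h) - L m < -(h * x) + |h| * ε := by
    rcases hx with ⟨y, hy, hd⟩ | ⟨y, hy, hd⟩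
    · refine ⟨y, hy, fun ε hε => exists_symmetric_quotient hG hy hε self_notMem_Iio
        (fun z hz => ?_) hd⟩
      have := mem_Iio.1 hz
      exact mem_Iio.2 (by linarith)
    · refine ⟨y, hy, fun ε hε => exists_symmetric_quotient hG hy hε self_notMem_Ioi
        (fun z hz => ?_) hd⟩
      have := mem_Ioi.1 hz
      exact mem_Ioi.2 (by linarith)
  have hle : EReal.exp (-legendre (extendTop G L) x) ≤
      ENNReal.ofReal (Real.exp (L y - y * x)) := by
    rw [← EReal.exp_coe]
    refine EReal.exp_monotone (EReal.neg_le_of_neg_le ?_)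
    rw [← EReal.coe_neg, neg_sub]
    exact le_legendre_extendTop hy x
  refine hle.trans ?_
  have hlim : Tendsto (fun ε : ℝ => ENNReal.ofReal
      (Real.exp (L y - y * x - ε - ε * |x| - (|y| + ε) * ε))) (𝓝[>] 0)
      (𝓝 (ENNReal.ofReal (Real.exp (L y - y * x)))) := by
    refine ENNReal.tendsto_ofReal (tendsto_nhdsWithin_of_tendsto_nhds ?_)
    have hc : Continuous fun ε : ℝ =>
        Real.exp (L y - y * x - ε - ε * |x| - (|y| + ε) * ε) := by fun_prop
    simpa using hc.tendsto 0
  refine le_of_tendsto hlim ?_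
  obtain ⟨r, hr, hrU⟩ := Metric.mem_nhds_iff.1 hU
  filter_upwards [Ioo_mem_nhdsGT hr] with ε hε
  obtain ⟨m, h, hm, hq, hp, hmy, hLm, h1, h2⟩ := hquot ε hε.1
  refine le_trans ?_ ((exp_le_liminf_ball ht_pos ht hL hm hq hp h1 h2).trans
    (liminf_le_liminf (Eventually.of_forall fun i => ENNReal.rpow_le_rpow
      (measure_mono ((Metric.ball_subset_ball hε.2.le).trans hrU)) (ht_pos i).le)))
  refine ENNReal.ofReal_le_ofReal (Real.exp_le_exp.2 ?_)
  have h3 : (m - y) * x ≤ ε * |x| := (le_abs_self _).trans (by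
    rw [abs_mul]
    exact mul_le_mul_of_nonneg_right hmy.le (abs_nonneg x))
  have h4 : |m| ≤ |y| + ε := by
    have := abs_add_le y (m - y)
    rw [add_sub_cancel] at this
    linarith
  have h5 := mul_le_mul_of_nonneg_right h4 hε.1.le
  linarith [(abs_lt.1 hLm).1]

end Lower

/-! ### Lower bounds outside the interior of the domain -/

section Boundary

variable {ι : Type*} {l : Filter ι} {μ : ι → Measure ℝ} {t : ι → ℝ}
  {G : Set ℝ} {L : ℝ → ℝ}

lemma exp_neg_legendre_le_exp (h0 : (0 : ℝ) ∈ G) (x : ℝ) :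
    EReal.exp (-legendre (extendTop G L) x) ≤ EReal.exp (L 0 : EReal) := by
  refine EReal.exp_monotone (EReal.neg_le_of_neg_le ?_)
  simpa using le_legendre_extendTop (L := L) h0 x

/-- A point where `lOne` does not exceed `-L 0` satisfies the lower bound, because
the transform is bounded below by `-L 0`. -/
lemma exp_neg_legendre_le_liminf_of_lOne_le (ht_pos : ∀ i, 0 < t i) (h0 : (0 : ℝ) ∈ G) {x : ℝ}
    (hx : lOne l μ t x ≤ -(L 0 : EReal)) {U : Set ℝ} (hU : U ∈ 𝓝 x) :
    EReal.exp (-legendre (extendTop G L) x) ≤ liminf (fun i => (μ i U) ^ t i) l := by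
  refine (exp_neg_legendre_le_exp h0 x).trans ?_
  rw [lOne, EReal.neg_le_neg_iff] at hx
  have h1 := EReal.exp_monotone hx
  rw [ENNReal.exp_log] at h1
  refine (h1.trans (iInf₂_le (interior U) ⟨isOpen_interior, mem_interior_iff_mem_nhds.2 hU⟩)).trans
    (liminf_le_liminf (Eventually.of_forall fun i => ?_))
  exact ENNReal.rpow_le_rpow (measure_mono interior_subset) (ht_pos i).le

/-- If the transform is infinite at `z` and finite at `x`, it is infinite at `z` already as a
supremum over the parameters pointing from `x` to `z`. -/
lemma exists_mem_lt_of_legendre_eq_top {x z a : ℝ}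
    (hx : legendre (extendTop G L) x = (a : EReal)) (hz : legendre (extendTop G L) z = ⊤) (M : ℝ) :
    ∃ y ∈ G, 0 ≤ y * (z - x) ∧ M < y * z - L y := by
  have : ((max M a : ℝ) : EReal) < legendre (extendTop G L) z := hz ▸ EReal.coe_lt_top _
  obtain ⟨y, hy, hyz⟩ := lt_legendre_extendTop_iff.1 this
  rw [EReal.coe_lt_coe_iff, max_lt_iff] at hyz
  have h := EReal.coe_le_coe_iff.1 (legendre_extendTop_le_iff.1 hx.le y hy)
  exact ⟨y, hy, by linarith [hyz.2], hyz.1⟩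

variable [l.NeBot]

/-- Where the transform is infinite, the half-line pointing away from its domain is
superexponentially negligible. -/
lemma limsup_halfLine_le_zero (ht_pos : ∀ i, 0 < t i)
    (hL : ∀ y ∈ G, HasLambda l μ t (fun x => y * x) (L y : EReal)) {x z a : ℝ}
    (hx : legendre (extendTop G L) x = (a : EReal)) (hz : legendre (extendTop G L) z = ⊤) :
    limsup (fun i => tiltedMass (μ i) (t i) 0 {w : ℝ | 0 ≤ (z - x) * (w - z)}) l ≤ 0 := by
  have hlim : Tendsto (fun M : ℝ => ENNReal.ofReal (Real.exp (-M))) atTop (𝓝 0) := by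
    rw [← ENNReal.ofReal_zero]
    exact ENNReal.tendsto_ofReal (Real.tendsto_exp_atBot.comp tendsto_neg_atTop_atBot)
  refine ge_of_tendsto hlim (Eventually.of_forall fun M => ?_)
  obtain ⟨y, hy, hyz, hM⟩ := exists_mem_lt_of_legendre_eq_top hx hz M
  have hne : 0 < (z - x) ^ 2 := by
    refine sq_pos_of_ne_zero (sub_ne_zero.2 fun h => EReal.coe_ne_top a ?_)
    rw [← hx, ← h, hz]
  have hmeas : MeasurableSet {w : ℝ | 0 ≤ (z - x) * (w - z)} :=
    measurableSet_le measurable_const (by fun_prop)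
  refine (limsup_tiltedMass_le_exp (b := -(y * z)) ht_pos (hL y hy) hmeas fun w hw => ?_).trans ?_
  · have h1 : 0 ≤ (z - x) ^ 2 * (y * (w - z)) := by
      have := mul_nonneg hyz hw
      linarith
    have h2 := nonneg_of_mul_nonneg_right h1 hne
    linarith
  · refine ENNReal.ofReal_le_ofReal (Real.exp_le_exp.2 ?_)
    linarith

/-- The degenerate case where the domain of the transform is a single point: then `0 ∈ G`, and
neighborhoods of that point carry the rate `L 0` of the total mass. -/
lemma exp_neg_legendre_le_liminf_of_subsingleton (ht_pos : ∀ i, 0 < t i) (ht : Tendsto t l (𝓝 0))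
    (hL : ∀ y ∈ G, HasLambda l μ t (fun x => y * x) (L y : EReal)) (hG : G.OrdConnected) {x a : ℝ}
    (hx : legendre (extendTop G L) x = (a : EReal))
    (htop : ∀ z, z ≠ x → legendre (extendTop G L) z = ⊤) {U : Set ℝ} (hU : U ∈ 𝓝 x) :
    EReal.exp (-legendre (extendTop G L) x) ≤ liminf (fun i => (μ i U) ^ t i) l := by
  have h0 : (0 : ℝ) ∈ G := by
    obtain ⟨y₁, hy₁, h₁, -⟩ := exists_mem_lt_of_legendre_eq_top hx (htop (x + 1) (by simp)) 0
    obtain ⟨y₂, hy₂, h₂, -⟩ := exists_mem_lt_of_legendre_eq_top hx (htop (x - 1) (by simp)) 0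
    exact hG.out hy₂ hy₁ ⟨by linarith, by linarith⟩
  refine (exp_neg_legendre_le_exp h0 x).trans ?_
  obtain ⟨r, hr, hrU⟩ := Metric.mem_nhds_iff.1 hU
  have hright := limsup_halfLine_le_zero ht_pos hL hx (htop (x + r) (by simp [hr.ne']))
  have hleft := limsup_halfLine_le_zero ht_pos hL hx (htop (x - r) (by simp [hr.ne']))
  have hfar := limsup_tiltedMass_union_le ht_pos ht 0 hright hleft
  have hcover : U ∪ ({w : ℝ | 0 ≤ (x + r - x) * (w - (x + r))} ∪
      {w : ℝ | 0 ≤ (x - r - x) * (w - (x - r))}) = univ := by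
    refine eq_univ_of_forall fun w => ?_
    by_cases hw : |w - x| < r
    · exact Or.inl (hrU (by rwa [Metric.mem_ball, Real.dist_eq]))
    · right
      rcases le_abs.1 (not_lt.1 hw) with h | h
      · left
        rw [mem_ofPred_eq, add_sub_cancel_left]
        exact mul_nonneg hr.le (by linarith)
      · right
        rw [mem_ofPred_eq, sub_sub_cancel_left]
        exact mul_nonneg_of_nonpos_of_nonpos (by linarith) (by linarith)
  have huniv := liminf_tiltedMass_univ (hL 0 h0)
  rw [← hcover] at huniv
  have h1 := liminf_tiltedMass_union_le ht_pos ht 0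
    (hfar.trans_lt (huniv ▸ ENNReal.ofReal_pos.2 (Real.exp_pos _)))
  rw [huniv, ← EReal.exp_coe] at h1
  simpa only [tiltedMass_zero] using h1

/-- The lower bound in the interior of the domain of the transform implies the lower bound at
every point, by convexity of the transform. -/
lemma exp_neg_legendre_le_liminf (ht_pos : ∀ i, 0 < t i) (ht : Tendsto t l (𝓝 0))
    (hL : ∀ y ∈ G, HasLambda l μ t (fun x => y * x) (L y : EReal)) (hG : G.OrdConnected)
    (hGne : G.Nonempty)
    (hint : ∀ x ∈ interior (effDom (legendre (extendTop G L))), ∀ U ∈ 𝓝 x,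
      EReal.exp (-legendre (extendTop G L) x) ≤ liminf (fun i => (μ i U) ^ t i) l)
    {x : ℝ} {U : Set ℝ} (hU : U ∈ 𝓝 x) :
    EReal.exp (-legendre (extendTop G L) x) ≤ liminf (fun i => (μ i U) ^ t i) l := by
  have hconv := convex_effDom_legendre (L := L) hGne
  by_cases hx : x ∈ effDom (legendre (extendTop G L))
  swap
  · have htop : legendre (extendTop G L) x = ⊤ := not_lt_top_iff.1 hx
    simp [htop]
  obtain ⟨a, ha⟩ := exists_legendre_eq_coe hGne hx
  rcases (interior (effDom (legendre (extendTop G L)))).eq_empty_or_nonempty with he | ⟨z, hz⟩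
  · refine exp_neg_legendre_le_liminf_of_subsingleton ht_pos ht hL hG ha (fun z hzx => ?_) hU
    by_contra hzt
    have hz : z ∈ effDom (legendre (extendTop G L)) := lt_top_iff_ne_top.2 hzt
    have hseg : Ioo (min z x) (max z x) ⊆ effDom (legendre (extendTop G L)) :=
      Ioo_subset_Icc_self.trans (hconv.ordConnected.uIcc_subset hz hx)
    have := (interior_maximal hseg isOpen_Ioo)
    rw [he] at this
    exact ((nonempty_Ioo.2 (min_lt_max.2 hzx)).mono this).ne_empty rfl
  · obtain ⟨b, hb⟩ := exists_legendre_eq_coe hGne (interior_subset hz)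
    have hlim : Tendsto (fun s : ℝ => ENNReal.ofReal (Real.exp (-((1 - s) * a + s * b)))) (𝓝[>] 0)
        (𝓝 (EReal.exp (-legendre (extendTop G L) x))) := by
      rw [ha, ← EReal.coe_neg, EReal.exp_coe]
      refine ENNReal.tendsto_ofReal (tendsto_nhdsWithin_of_tendsto_nhds ?_)
      have hc : Continuous fun s : ℝ => Real.exp (-((1 - s) * a + s * b)) := by fun_prop
      simpa using hc.tendsto 0
    have hpt : Tendsto (fun s : ℝ => (1 - s) * x + s * z) (𝓝[>] 0) (𝓝 x) := by
      refine tendsto_nhdsWithin_of_tendsto_nhds ?_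
      have hc : Continuous fun s : ℝ => (1 - s) * x + s * z := by fun_prop
      simpa using hc.tendsto 0
    refine le_of_tendsto hlim ?_
    filter_upwards [Ioo_mem_nhdsGT one_pos, hpt.eventually (eventually_mem_nhds_iff.2 hU)]
      with s hs hsU
    refine le_trans ?_ (hint _ (hconv.combo_self_interior_mem_interior hx hz
      (sub_nonneg.2 hs.2.le) hs.1 (sub_add_cancel 1 s)) U hsU)
    rw [← EReal.exp_coe, EReal.coe_neg]
    exact EReal.exp_monotone
      (EReal.neg_le_neg_iff.2 (legendre_segment_le ha.le hb.le hs.1.le hs.2.le))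

/-- The transform is nonnegative as soon as it controls the total masses, which are at most `1`. -/
lemma legendre_nonneg (hμ : ∀ i, μ i univ ≤ 1) (ht_pos : ∀ i, 0 < t i) {x : ℝ}
    (h : EReal.exp (-legendre (extendTop G L) x) ≤ liminf (fun i => (μ i univ) ^ t i) l) :
    0 ≤ legendre (extendTop G L) x := by
  have h1 : liminf (fun i => (μ i univ) ^ t i) l ≤ 1 :=
    liminf_le_of_frequently_le (Eventually.of_forall fun i =>
      ENNReal.rpow_le_one (hμ i) (ht_pos i).le).frequently
  have h2 := EReal.exp_le_one_iff.1 (h.trans h1)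
  simpa using EReal.neg_le_of_neg_le h2

end Boundary

/-! ### The essentially smooth case -/

section Smooth

variable {G : Set ℝ} {L : ℝ → ℝ}

/-- If the transform of a steep convex `L` is finite at some `z > x`, then `L'` reaches `x`:
otherwise `L' < x` on `G`, which contradicts steepness at the right end of `G` if that end is
finite, and the finiteness of the transform at `z` if it is not. -/
lemma exists_le_deriv (hG : IsOpen G) (hGc : G.OrdConnected) (hGne : G.Nonempty)
    (hd : ∀ y ∈ G, DifferentiableAt ℝ L y) (hmono : MonotoneOn (deriv L) G)
    (hsteep : ∀ (u : ℕ → ℝ) (b : ℝ), (∀ n, u n ∈ G) → b ∉ G → Tendsto u atTop (𝓝 b) →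
      Tendsto (fun n => |deriv L (u n)|) atTop atTop)
    {x z C : ℝ} (hxz : x < z) (hC : ∀ y ∈ G, y * z - L y ≤ C) :
    ∃ y ∈ G, x ≤ deriv L y := by
  by_contra! hlt
  obtain ⟨g, hg⟩ := hGne
  by_cases hb : BddAbove G
  · obtain ⟨u, hu, hub⟩ := mem_closure_iff_seq_limit.1 (csSup_mem_closure ⟨g, hg⟩ hb)
    have hnot : sSup G ∉ G := fun hmem => by
      obtain ⟨w, hwG, hw⟩ := (((hG.eventually_mem hmem).filter_mono nhdsWithin_le_nhds).and
        (eventually_mem_nhdsWithin (a := sSup G) (s := Ioi (sSup G)))).exists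
      exact (mem_Ioi.1 hw).not_ge (le_csSup hb hwG)
    have hgb : g < sSup G := (le_csSup hb hg).lt_of_ne fun h => hnot (h ▸ hg)
    obtain ⟨n, hn, hgn⟩ := (((hsteep u _ hu hnot hub).eventually_gt_atTop
      (max |deriv L g| |x|)).and (hub.eventually_const_lt hgb)).exists
    exact hn.not_ge (abs_le_max_abs_abs (hmono hg (hu n) hgn.le) (hlt _ (hu n)).le)
  · obtain ⟨y, hy, hyM⟩ := not_bddAbove_iff.1 hb (max g ((C + L g - x * g) / (z - x)))
    rw [max_lt_iff, div_lt_iff₀ (sub_pos.2 hxz)] at hyM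
    have hmv := hGc.convex.image_sub_le_mul_sub_of_deriv_le
      (fun w hw => (hd w hw).continuousAt.continuousWithinAt)
      (fun w hw => (hd w (interior_subset hw)).differentiableWithinAt)
      (fun w hw => (hlt w (interior_subset hw)).le) g hg y hy hyM.1.le
    linarith [hC y hy, hyM.2]

lemma effDom_extendTop : effDom (extendTop G L) = G := by
  ext y
  by_cases hy : y ∈ G <;> simp [effDom, extendTop, hy]

lemma interior_effDom_legendre_subset_of_essentiallySmooth (hG : IsOpen G) (hGc : G.OrdConnected)
    (hGne : G.Nonempty) (h : EssentiallySmooth (extendTop G L)) :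
    interior (effDom (legendre (extendTop G L))) ⊆ ranLeftDeriv G L ∪ ranRightDeriv G L := by
  have heq : ∀ y ∈ G, (fun y => (extendTop G L y).toReal) =ᶠ[𝓝 y] L := fun y hy => by
    filter_upwards [hG.mem_nhds hy] with w hw
    simp [extendTop, hw]
  have hint : interior (effDom (extendTop G L)) = G := by rw [effDom_extendTop, hG.interior_eq]
  have hd : ∀ y ∈ G, DifferentiableAt ℝ L y := fun y hy =>
    (heq y hy).differentiableAt_iff.1 (h.differentiable y (hint.symm ▸ hy))
  have hconv : ConvexOn ℝ G L := by
    refine convexOn_of_convex_epigraph ?_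
    convert h.properConvex.1 using 1
    ext p
    by_cases hp : p.1 ∈ G <;> simp [extendTop, hp]
  have hmono := hconv.monotoneOn_deriv hd
  have hsteep : ∀ (u : ℕ → ℝ) (b : ℝ), (∀ n, u n ∈ G) → b ∉ G → Tendsto u atTop (𝓝 b) →
      Tendsto (fun n => |deriv L (u n)|) atTop atTop := fun u b hu hb hub => by
    have hfr : b ∈ frontier (effDom (extendTop G L)) := by
      rw [effDom_extendTop, hG.frontier_eq]
      exact ⟨mem_closure_of_tendsto hub (Eventually.of_forall hu), hb⟩
    refine (h.steep u b (fun n => hint.symm ▸ hu n) hfr hub).congr fun n => ?_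
    rw [(heq _ (hu n)).deriv_eq]
  intro x hx
  obtain ⟨r, hr, hball⟩ := Metric.mem_nhds_iff.1 (mem_interior_iff_mem_nhds.1 hx)
  have hfin : ∀ z, |z - x| < r → ∃ C : ℝ, ∀ y ∈ G, y * z - L y ≤ C := fun z hz => by
    obtain ⟨C, hC⟩ := exists_legendre_eq_coe hGne (hball (show z ∈ Metric.ball x r from hz))
    exact ⟨C, fun y hy => EReal.coe_le_coe_iff.1 (legendre_extendTop_le_iff.1 hC.le y hy)⟩
  obtain ⟨C₁, hC₁⟩ := hfin (x + r / 2) (by rw [add_sub_cancel_left, abs_of_pos] <;> linarith)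
  obtain ⟨C₂, hC₂⟩ := hfin (x - r / 2)
    (by rw [sub_sub_cancel_left, abs_neg, abs_of_pos] <;> linarith)
  obtain ⟨y₁, hy₁, hxy₁⟩ := exists_le_deriv hG hGc hGne hd hmono hsteep
    (show x < x + r / 2 by linarith) hC₁
  -- The inequality from the other side follows by reflecting `G` and `L` at the origin.
  obtain ⟨y₂, hy₂, hxy₂⟩ := exists_le_deriv (G := -G) (L := fun y => L (-y)) (x := -x)
    (z := -(x - r / 2)) (C := C₂) hG.neg
    (ordConnected_def.2 fun a ha b hb c hc => hGc.out hb ha ⟨neg_le_neg hc.2, neg_le_neg hc.1⟩)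
    hGne.neg (fun y hy => (hd (-y) hy).comp y differentiable_neg.differentiableAt)
    (fun a ha b hb hab => by
      rw [deriv_comp_neg, deriv_comp_neg, neg_le_neg_iff]
      exact hmono hb ha (neg_le_neg hab))
    (fun u b hu hb hub => by
      simp only [deriv_comp_neg, abs_neg]
      exact hsteep (fun n => -u n) (-b) hu hb hub.neg)
    (by linarith) (fun y hy => by
      have := hC₂ (-y) hy
      linarith)
  rw [deriv_comp_neg, neg_le_neg_iff] at hxy₂
  obtain ⟨y, hy, rfl⟩ := (hGc.image_deriv hd).out (mem_image_of_mem _ hy₂)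
    (mem_image_of_mem _ hy₁) ⟨hxy₂, hxy₁⟩
  exact Or.inl ⟨y, hy, (hd y hy).hasDerivAt.hasDerivWithinAt⟩

end Smooth

end LargeDev

theorem mainTheorem2 {ι : Type*} [Preorder ι] [IsDirectedOrder ι] [Nonempty ι]
    (μ : ι → Measure ℝ) (hμ : ∀ i, μ i univ ≤ 1)
    (t : ι → ℝ) (ht_pos : ∀ i, 0 < t i) (ht : Tendsto t atTop (𝓝 0))
    (G : Set ℝ) (hG_open : IsOpen G) (hG_int : G.OrdConnected) (hG_ne : G.Nonempty)
    (L : ℝ → ℝ)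
    (hL : ∀ y ∈ G, LargeDev.HasLambda atTop μ t (fun x => y * x) (L y : EReal)) :
    -- (a), first part: the vague principle
    (interior (LargeDev.effDom (LargeDev.legendre (LargeDev.extendTop G L))) ⊆
        LargeDev.ranLeftDeriv G L ∪ LargeDev.ranRightDeriv G L →
      LargeDev.VagueLDP atTop μ t (LargeDev.legendre (LargeDev.extendTop G L))) ∧
    -- (a), second part: the covering condition holds in the essentially smooth case
    (LargeDev.EssentiallySmooth (LargeDev.extendTop G L) →
      interior (LargeDev.effDom (LargeDev.legendre (LargeDev.extendTop G L))) ⊆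
        LargeDev.ranLeftDeriv G L ∪ LargeDev.ranRightDeriv G L) ∧
    -- (b): the narrow principle
    ((0 : ℝ) ∈ G →
      interior (LargeDev.effDom (LargeDev.legendre (LargeDev.extendTop G L))) ∩
          {x | -(L 0 : EReal) < LargeDev.lOne atTop μ t x} ⊆
        LargeDev.ranLeftDeriv G L ∪ LargeDev.ranRightDeriv G L →
      LargeDev.NarrowLDP atTop μ t (LargeDev.legendre (LargeDev.extendTop G L))) := by
  have hlower : (∀ x ∈ interior (LargeDev.effDom (LargeDev.legendre (LargeDev.extendTop G L))),
      ∀ U ∈ 𝓝 x, EReal.exp (-LargeDev.legendre (LargeDev.extendTop G L) x) ≤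
        liminf (fun i => (μ i U) ^ t i) atTop) →
      ∀ x, ∀ U ∈ 𝓝 x, EReal.exp (-LargeDev.legendre (LargeDev.extendTop G L) x) ≤
        liminf (fun i => (μ i U) ^ t i) atTop := fun hint x U hU =>
    LargeDev.exp_neg_legendre_le_liminf ht_pos ht hL hG_int hG_ne hint hU
  refine ⟨fun hran => ?_,
    LargeDev.interior_effDom_legendre_subset_of_essentiallySmooth hG_open hG_int hG_ne,
    fun h0 hran => ?_⟩
  · have hlow := hlower fun x hx U hU =>
      LargeDev.exp_neg_legendre_le_liminf_of_mem_ran ht_pos ht hL hG_open (hran hx) hU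
    exact
      { nonneg := fun x => LargeDev.legendre_nonneg hμ ht_pos (hlow x univ univ_mem)
        lsc := LargeDev.lowerSemicontinuous_legendre
        upper := fun K hK => LargeDev.limsup_isCompact_le ht_pos ht hL hK
        lower := fun U hU => iSup₂_le fun x hx => hlow x U (hU.mem_nhds hx) }
  · have hlow := hlower fun x hx U hU => by
      by_cases hl : -(L 0 : EReal) < LargeDev.lOne atTop μ t x
      · exact LargeDev.exp_neg_legendre_le_liminf_of_mem_ran ht_pos ht hL hG_open
          (hran ⟨hx, hl⟩) hU
      · exact LargeDev.exp_neg_legendre_le_liminf_of_lOne_le ht_pos h0 (not_lt.1 hl) hU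
    exact
      { nonneg := fun x => LargeDev.legendre_nonneg hμ ht_pos (hlow x univ univ_mem)
        lsc := LargeDev.lowerSemicontinuous_legendre
        upper := fun F hF => LargeDev.limsup_isClosed_le ht_pos ht hL (hG_open.mem_nhds h0) hF
        lower := fun U hU => iSup₂_le fun x hx => hlow x U (hU.mem_nhds hx) }
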